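/- Let $M$ be a closed, connected, oriented hyperbolic surface, i.e. a nonempty compact connected Hausdorff space with an atlas of charts to the hyperbolic plane $\mathbb{H}^2$ (upper half-plane, curvature $-1$) whose transition maps are locally orientation-preserving isometries of $\mathbb{H}^2$; $M$ carries the Riemannian metric for which the charts are isometries. For $p\in M$ let the injectivity radius $\operatorname{inj}(p)\in[0,\infty]$ be the supremum of all $r\ge 0$ such that the open hyperbolic disc of radius $r$ admits an injective local isometry into $M$ sending its centre to $p$ (equivalently, such that the exponential map at $p$ is injective on the open disc of radius $r$). Then there exists a point $p\in M$ with $\operatorname{inj}(p)\ge 0.13$. -/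

import Mathlib

open scoped UpperHalfPlane MatrixGroups Manifold Topology ENNReal NNReal

/-- The pseudogroup of local orientation-preserving isometries of the hyperbolic plane: maps that
near every point of their domain coincide with the action of an element of `SL(2, ℝ)`
by a Möbius transformation. -/
def hyperbolicPregroupoid : Pregroupoid ℍ where
  property f s := ∀ z ∈ s, ∃ γ : SL(2, ℝ), ∀ᶠ w in 𝓝 z, f w = γ • w
  comp := by
    intro f g u v hf hg _ _ _ z hz
    obtain ⟨γ, hγ⟩ := hf z hz.1
    obtain ⟨δ, hδ⟩ := hg (f z) hz.2
    have hz' : f z = γ • z := hγ.self_of_nhds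
    have hc : Filter.Tendsto (fun w : ℍ => γ • w) (𝓝 z) (𝓝 (f z)) := by
      rw [hz']
      exact (isometry_smul ℍ γ).continuous.tendsto z
    refine ⟨δ * γ, ?_⟩
    filter_upwards [hγ, hc.eventually hδ] with w h1 h2
    rw [Function.comp_apply, h1, h2, mul_smul]
  id_mem := fun _ _ => ⟨1, Filter.Eventually.of_forall fun w => (one_smul _ w).symm⟩
  locality := by
    intro f u _ h z hz
    obtain ⟨v, _, hzv, hv⟩ := h z hz
    exact hv z ⟨hz, hzv⟩
  congr := by
    intro f g u hu hfg hf z hz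
    obtain ⟨γ, hγ⟩ := hf z hz
    refine ⟨γ, ?_⟩
    filter_upwards [hγ, hu.mem_nhds hz] with w h1 h2
    rw [hfg w h2, h1]

/-- The structure groupoid on `ℍ` of all homeomorphisms between open subsets of `ℍ` that are
locally orientation-preserving hyperbolic isometries. -/
noncomputable def hyperbolicGroupoid : StructureGroupoid ℍ :=
  hyperbolicPregroupoid.groupoid

/-- A closed, connected, oriented hyperbolic surface: a nonempty connected compact Hausdorff space
with an atlas of charts to the hyperbolic plane `ℍ` whose transition maps are locally
orientation-preserving hyperbolic isometries. The hyperbolic metric of `M` is the one that makes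
all charts isometries. -/
class ClosedHyperbolicSurface (M : Type*) [TopologicalSpace M] [ChartedSpace ℍ M] : Prop
    extends HasGroupoid M hyperbolicGroupoid, CompactSpace M, T2Space M, ConnectedSpace M

/-- `f : ℍ → M` is a local (Riemannian) isometry on the set `s`: near every point of `s`, the map
`f`, read in a chart of `M`, coincides with an isometry of the hyperbolic plane (which may
preserve or reverse orientation). -/
def IsLocalHyperbolicIsometryOn {M : Type*} [TopologicalSpace M] [ChartedSpace ℍ M]
    (f : ℍ → M) (s : Set ℍ) : Prop :=
  ∀ z ∈ s, ∃ γ : ℍ ≃ᵢ ℍ, ∀ᶠ w in 𝓝 z,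
    f w ∈ (chartAt ℍ (f z)).source ∧ chartAt ℍ (f z) (f w) = γ w

/-- The open hyperbolic disc of radius `r` embeds isometrically (in the Riemannian sense: by an
injective local isometry) into `M` with its centre mapped to `p`. Such a map is the exponential
map at `p` restricted to the disc of radius `r` in the tangent plane at `p`. -/
def HasEmbeddedDisc {M : Type*} [TopologicalSpace M] [ChartedSpace ℍ M] (p : M) (r : ℝ) : Prop :=
  ∃ (z : ℍ) (f : ℍ → M), f z = p ∧ IsLocalHyperbolicIsometryOn f (Metric.ball z r) ∧
    Set.InjOn f (Metric.ball z r)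

/-- The injectivity radius at `p`: the supremum, in `[0, ∞]`, of the radii `r` such that the
hyperbolic disc of radius `r` embeds isometrically into `M` with centre `p`. -/
noncomputable def injectivityRadius {M : Type*} [TopologicalSpace M] [ChartedSpace ℍ M] (p : M) :
    ℝ≥0∞ :=
  ⨆ (r : ℝ≥0) (_ : HasEmbeddedDisc p r), (r : ℝ≥0∞)

/-!
The surface `M` is unrolled to `ℍ`: by compactness every germ of an orientation-preserving local
isometry `ℍ → M` extends to a disc of a fixed radius `ε` and is injective there
(`exists_uniform_extension`), so gluing such extensions over growing discs about `i` gives a local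
isometry `f : ℍ → M` defined everywhere (`exists_developing`). Gluing needs only the identity
principle `eqOn_of_isPreconnected` and the fact that hyperbolic discs are Euclidean discs, so that
their intersections are convex. The elements `γ` of `SL(2, ℝ)` with `f ∘ γ = f` form a group `Γ`,
and two points with the same image under `f` differ by an element of `Γ`. All elements of `Γ` other
than `±1` move every point by at least `ε`, and the disc of radius `r` about `z` embeds as soon as
all of them move `z` by at least `2 r`.

It remains to find a point that all elements of `Γ` other than `±1` move by at least `0.26`
(`exists_forall_dist_smul_ge`). Measure the displacement by `sinh² (d(z, γ z) / 2)`, which for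
`γ = (a, b; c, d)` is `|c z² + (d - a) z - b|² / (4 (Im z)²)`. Suppose that every point is moved by
less than `0.26` by some element, and let `m > 0` be a lower bound for the displacements at `z`,
with `γ` moving `z` almost that little. If `δ` also moves `z` by less than `0.3`, then the
commutator of `γ` and `δ` moves `z` strictly less than `γ` does
(`displacement_commutator_I_le`; this uses `(tr γ)² ≥ 4`, which holds because `Γ` has no elliptic
elements), hence it is `±1`, and `γ` and `δ` commute. Then the quadratic polynomials of `γ` and `δ`
are proportional, so the displacements of `γ` and `δ` have a constant ratio on `ℍ`. The displacement
of `γ` grows by a definite factor if `z` is moved suitably by at most `1 / 60`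
(`exists_displacement_gain`), and so do the displacements of all such `δ`; the other elements still
move the new point by more than `0.26`. So the lower bound `m` improves by a fixed factor
(`exists_displacement_ge`), and iterating this contradicts its boundedness.
-/

namespace HyperbolicSurface

/-! ### The displacement function of an element of `SL(2, ℝ)` -/

/-- The displacement of `z` under the Möbius transformation `γ`, measured by `sinh² (d(z, γ z) / 2)`
instead of the distance, which makes it a rational function of the entries of `γ` and of the
coordinates of `z`. -/
noncomputable def displacement (γ : SL(2, ℝ)) (z : ℍ) : ℝ :=
  Real.sinh (dist z (γ • z) / 2) ^ 2

/-- The numerator is `|c z² + (d - a) z - b|²`, written out in real coordinates. -/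
theorem displacement_eq (γ : SL(2, ℝ)) (z : ℍ) :
    displacement γ z =
      ((γ 1 0 * (z.re ^ 2 - z.im ^ 2) + (γ 1 1 - γ 0 0) * z.re - γ 0 1) ^ 2 +
        (2 * γ 1 0 * z.re * z.im + (γ 1 1 - γ 0 0) * z.im) ^ 2) / (4 * z.im ^ 2) := by
  have hy := z.im_pos
  have hden : ((γ 1 0 : ℝ) : ℂ) * z + (γ 1 1 : ℝ) ≠ 0 := UpperHalfPlane.denom_ne_zero γ z
  have him : (γ • z).im = z.im / Complex.normSq ((γ 1 0 : ℝ) * z + (γ 1 1 : ℝ)) :=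
    by
    have h := UpperHalfPlane.im_smul_eq_div_normSq (Matrix.SpecialLinearGroup.mapGL ℝ γ) z
    rw [Matrix.SpecialLinearGroup.det_mapGL, Units.val_one, abs_one, one_mul] at h
    exact h
  have hcoe : ((γ • z : ℍ) : ℂ) = (γ 0 0 * z + γ 0 1) / (γ 1 0 * z + γ 1 1) :=
    UpperHalfPlane.coe_specialLinearGroup_apply γ z
  have hN : 0 < Complex.normSq (((γ 1 0 : ℝ) : ℂ) * z + (γ 1 1 : ℝ)) := Complex.normSq_pos.2 hden
  have hdiff : (z : ℂ) - (γ • z : ℍ) =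
      (γ 1 0 * z ^ 2 + (γ 1 1 - γ 0 0) * z - γ 0 1) / (γ 1 0 * z + γ 1 1) := by
    rw [hcoe, eq_div_iff hden, sub_mul, div_mul_cancel₀ _ hden]; ring
  have hq : Complex.normSq (γ 1 0 * (z : ℂ) ^ 2 + (γ 1 1 - γ 0 0) * z - γ 0 1) =
      (γ 1 0 * (z.re ^ 2 - z.im ^ 2) + (γ 1 1 - γ 0 0) * z.re - γ 0 1) ^ 2 +
        (2 * γ 1 0 * z.re * z.im + (γ 1 1 - γ 0 0) * z.im) ^ 2 := by
    simp [Complex.normSq_apply, pow_two]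
    ring
  rw [displacement, UpperHalfPlane.sinh_half_dist, div_pow, mul_pow,
    Real.sq_sqrt (mul_pos hy (γ • z).im_pos).le, Complex.dist_eq, Complex.sq_norm, hdiff,
    map_div₀, hq, him]
  field_simp
  ring

theorem displacement_I (γ : SL(2, ℝ)) :
    displacement γ UpperHalfPlane.I = ((γ 0 1 + γ 1 0) ^ 2 + (γ 0 0 - γ 1 1) ^ 2) / 4 := by
  rw [displacement_eq]; simp; ring

theorem cosh_dist_eq (γ : SL(2, ℝ)) (z : ℍ) :
    Real.cosh (dist z (γ • z)) = 1 + 2 * displacement γ z := by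
  have h := Real.cosh_two_mul (dist z (γ • z) / 2)
  have h' := Real.cosh_sq (dist z (γ • z) / 2)
  rw [displacement]
  rw [mul_div_cancel₀ _ two_ne_zero] at h
  linarith

theorem det_eq (γ : SL(2, ℝ)) : γ 0 0 * γ 1 1 - γ 0 1 * γ 1 0 = 1 := by
  have := γ.det_coe; rwa [Matrix.det_fin_two] at this

/-- Elliptic elements have a fixed point: the root `((a - d) + i √(4 - tr²)) / (2 c)` of
`c z² + (d - a) z - b`, up to complex conjugation. -/
theorem exists_fixedPoint_of_trace_sq_lt (γ : SL(2, ℝ)) (h : (γ 0 0 + γ 1 1) ^ 2 < 4) :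
    ∃ z : ℍ, γ • z = z := by
  have hdet := det_eq γ
  have hc : γ 1 0 ≠ 0 := by
    intro hc
    rw [hc] at hdet
    nlinarith [sq_nonneg (γ 0 0 - γ 1 1)]
  have hD : 0 < 4 - (γ 0 0 + γ 1 1) ^ 2 := by linarith
  have hs := Real.sqrt_pos.2 hD
  have hs2 := Real.sq_sqrt hD.le
  set s := √(4 - (γ 0 0 + γ 1 1) ^ 2)
  have hc' : 0 < |γ 1 0| := abs_pos.2 hc
  refine ⟨⟨⟨(γ 0 0 - γ 1 1) / (2 * γ 1 0), s / (2 * |γ 1 0|)⟩, by simp; positivity⟩, ?_⟩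
  refine (dist_eq_zero.1 ?_).symm
  have hsq : displacement γ ⟨⟨(γ 0 0 - γ 1 1) / (2 * γ 1 0), s / (2 * |γ 1 0|)⟩,
      by simp; positivity⟩ = 0 := by
    rw [displacement_eq]
    have e1 : γ 1 0 * (((γ 0 0 - γ 1 1) / (2 * γ 1 0)) ^ 2 - (s / (2 * |γ 1 0|)) ^ 2) +
      (γ 1 1 - γ 0 0) * ((γ 0 0 - γ 1 1) / (2 * γ 1 0)) - γ 0 1 = 0 := by
      rw [div_pow s, mul_pow 2 |γ 1 0|, sq_abs, hs2]
      field_simp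
      linear_combination 4 * hdet
    have e2 : 2 * γ 1 0 * ((γ 0 0 - γ 1 1) / (2 * γ 1 0)) * (s / (2 * |γ 1 0|)) +
      (γ 1 1 - γ 0 0) * (s / (2 * |γ 1 0|)) = 0 := by
      field_simp
      ring
    simp only [UpperHalfPlane.re, UpperHalfPlane.im]
    rw [e1, e2]; simp
  rw [displacement, sq_eq_zero_iff, Real.sinh_eq_zero] at hsq
  linarith

/-- Bound for twice the squared Frobenius norm of `γ δ - δ γ`. In suitable coordinates on the
traceless matrices the commutator is a cross product, bounded by Lagrange's identity; `tr² ≥ 4`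
bounds the skew part `b - c` of a matrix by its traceless symmetric part. -/
theorem sq_norm_commutator_le {a b c d a' b' c' d' : ℝ} (hdγ : a * d - b * c = 1)
    (hdδ : a' * d' - b' * c' = 1) (hγ : 4 ≤ (a + d) ^ 2) (hδ : 4 ≤ (a' + d') ^ 2) :
    2 * (2 * (b * c' - b' * c) ^ 2 + (b' * (a - d) - b * (a' - d')) ^ 2 +
      (c * (a' - d') - c' * (a - d)) ^ 2) ≤
      2 * ((b + c) ^ 2 + (a - d) ^ 2) * (2 * ((b' + c') ^ 2 + (a' - d') ^ 2)) := by
  have hX : ((a - d) ^ 2 + (b + c) ^ 2 + (b - c) ^ 2) ≤ 2 * ((b + c) ^ 2 + (a - d) ^ 2) := by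
    linarith
  have hY : ((a' - d') ^ 2 + (b' + c') ^ 2 + (b' - c') ^ 2) ≤
      2 * ((b' + c') ^ 2 + (a' - d') ^ 2) := by
    linarith
  -- Lagrange's identity: the difference of the two sides is the square of an inner product
  have hcomm : 2 * (2 * (b * c' - b' * c) ^ 2 + (b' * (a - d) - b * (a' - d')) ^ 2 +
      (c * (a' - d') - c' * (a - d)) ^ 2) ≤
      ((a - d) ^ 2 + (b + c) ^ 2 + (b - c) ^ 2) *
        ((a' - d') ^ 2 + (b' + c') ^ 2 + (b' - c') ^ 2) := by
    rw [← sub_nonneg]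
    refine (sq_nonneg ((a - d) * (a' - d') + (b + c) * (b' + c') + (b - c) * (b' - c'))).trans_eq ?_
    ring
  have hXY := mul_le_mul hX hY (by positivity) (by positivity)
  exact hcomm.trans hXY

/-- For `M = N' P⁻¹` with `N'` traceless and `det P = 1`, the traceless symmetric part of `M` is
bounded by the product of the Frobenius norms of `N'` and `P`. -/
theorem sq_norm_mul_adjugate_le (N K L p q r t : ℝ) :
    ((-N * q + K * p + L * t + N * r) ^ 2 + (N * (t + p) - K * r + L * q) ^ 2) / 4 ≤
      (2 * N ^ 2 + K ^ 2 + L ^ 2) * (p ^ 2 + q ^ 2 + r ^ 2 + t ^ 2) / 2 := by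
  have h1 : (N * t - K * r) ^ 2 ≤ (N ^ 2 + K ^ 2) * (t ^ 2 + r ^ 2) := by
    nlinarith [sq_nonneg (N * r + K * t)]
  have h2 : (K * p - N * q) ^ 2 ≤ (N ^ 2 + K ^ 2) * (p ^ 2 + q ^ 2) := by
    nlinarith [sq_nonneg (K * q + N * p)]
  have h3 : (L * t + N * r) ^ 2 ≤ (N ^ 2 + L ^ 2) * (t ^ 2 + r ^ 2) := by
    nlinarith [sq_nonneg (L * r - N * t)]
  have h4 : (L * q + N * p) ^ 2 ≤ (N ^ 2 + L ^ 2) * (p ^ 2 + q ^ 2) := by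
    nlinarith [sq_nonneg (L * p - N * q)]
  linarith [sq_nonneg ((K * p - N * q) - (L * t + N * r)),
    sq_nonneg ((N * t - K * r) - (L * q + N * p))]

/-- The commutator estimate behind the Margulis lemma: with `P = δ γ`, the commutator of `γ` and `δ`
is `1 + (γ δ - δ γ) P⁻¹`, so its displacement at `i` is bounded by the product of those of `γ`
and `δ`, up to a factor close to `32`. -/
theorem displacement_commutator_I_le (γ δ : SL(2, ℝ)) (hγ : 4 ≤ (γ 0 0 + γ 1 1) ^ 2)
    (hδ : 4 ≤ (δ 0 0 + δ 1 1) ^ 2) :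
    displacement (γ * δ * γ⁻¹ * δ⁻¹) UpperHalfPlane.I ≤
      32 * displacement γ UpperHalfPlane.I * displacement δ UpperHalfPlane.I *
        Real.cosh (dist UpperHalfPlane.I ((δ * γ) • UpperHalfPlane.I)) := by
  have hdγ := det_eq γ
  have hdδ := det_eq δ
  have hdP := det_eq (δ * γ)
  -- the squared Frobenius norm of an element of `SL(2, ℝ)` is `2 cosh` of the distance it moves `i`
  have hP : (δ * γ) 0 0 ^ 2 + (δ * γ) 0 1 ^ 2 + (δ * γ) 1 0 ^ 2 + (δ * γ) 1 1 ^ 2 =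
      2 * Real.cosh (dist UpperHalfPlane.I ((δ * γ) • UpperHalfPlane.I)) := by
    rw [cosh_dist_eq, displacement_I]; linear_combination 2 * hdP
  have hP1 := Real.one_le_cosh (dist UpperHalfPlane.I ((δ * γ) • UpperHalfPlane.I))
  generalize Real.cosh (dist UpperHalfPlane.I ((δ * γ) • UpperHalfPlane.I)) = P at *
  rw [displacement_I, displacement_I γ, displacement_I δ]
  have hκ : γ * δ * γ⁻¹ * δ⁻¹ = (γ * δ) * (δ * γ)⁻¹ := by group
  rw [hκ]
  simp only [Matrix.SpecialLinearGroup.coe_mul, Matrix.SpecialLinearGroup.coe_inv,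
    Matrix.adjugate_fin_two, Matrix.mul_apply, Fin.sum_univ_two, Matrix.of_apply,
    Matrix.cons_val_zero, Matrix.cons_val_one, Matrix.cons_val',
    Matrix.cons_val_fin_one] at hP hdP ⊢
  generalize γ 0 0 = a, γ 0 1 = b, γ 1 0 = c, γ 1 1 = d, δ 0 0 = a', δ 0 1 = b', δ 1 0 = c',
    δ 1 1 = d' at *
  generalize hp : a' * a + b' * c = p at *
  generalize hq : a' * b + b' * d = q at *
  generalize hr : c' * a + d' * c = r at *
  generalize ht : c' * b + d' * d = t at *
  -- `!![N, K; L, -N]` is `γ δ - δ γ`, and `!![p, q; r, t]` is `δ γ`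
  obtain ⟨N, hN⟩ : ∃ N, N = b * c' - b' * c := ⟨_, rfl⟩
  obtain ⟨K, hK⟩ : ∃ K, K = b' * (a - d) - b * (a' - d') := ⟨_, rfl⟩
  obtain ⟨L, hL⟩ : ∃ L, L = c * (a' - d') - c' * (a - d) := ⟨_, rfl⟩
  have e1 : a * a' + b * c' = p + N := by rw [hN, ← hp]; ring
  have e2 : a * b' + b * d' = q + K := by rw [hK, ← hq]; ring
  have e3 : c * a' + d * c' = r + L := by rw [hL, ← hr]; ring
  have e4 : c * b' + d * d' = t - N := by rw [hN, ← ht]; ring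
  rw [e1, e2, e3, e4]
  calc _ = ((-N * q + K * p + L * t + N * r) ^ 2 + (N * (t + p) - K * r + L * q) ^ 2) / 4 := by
        congr 2 <;> ring
    _ ≤ (2 * N ^ 2 + K ^ 2 + L ^ 2) * (p ^ 2 + q ^ 2 + r ^ 2 + t ^ 2) / 2 :=
      sq_norm_mul_adjugate_le N K L p q r t
    _ = (2 * (2 * N ^ 2 + K ^ 2 + L ^ 2)) * P / 2 := by rw [hP]; ring
    _ ≤ (2 * ((b + c) ^ 2 + (a - d) ^ 2) * (2 * ((b' + c') ^ 2 + (a' - d') ^ 2))) * P / 2 := by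
      have := mul_le_mul_of_nonneg_right (sq_norm_commutator_le hdγ hdδ hγ hδ)
        (zero_le_one.trans hP1)
      rw [hN, hK, hL]
      linarith
    _ = _ := by ring

/-! ### Groups without short displacements -/

theorem commute_of_commutator_eq_one_or_neg_one {γ δ : SL(2, ℝ)} (hδ : 4 ≤ (δ 0 0 + δ 1 1) ^ 2)
    (h : γ * δ * γ⁻¹ * δ⁻¹ = 1 ∨ γ * δ * γ⁻¹ * δ⁻¹ = -1) : γ * δ = δ * γ := by
  rcases h with h | h
  · rw [mul_inv_eq_one, mul_inv_eq_iff_eq_mul] at h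
    exact h
  · -- the traces of the conjugate elements `δ` and `-δ` would agree
    rw [mul_inv_eq_iff_eq_mul, mul_inv_eq_iff_eq_mul] at h
    have hγ := det_eq γ
    have e (i j : Fin 2) : (γ * δ) i j = (-1 * δ * γ) i j := by rw [h]
    have e00 := e 0 0
    have e01 := e 0 1
    have e10 := e 1 0
    have e11 := e 1 1
    simp only [Matrix.SpecialLinearGroup.coe_mul, Matrix.SpecialLinearGroup.coe_neg,
      Matrix.mul_apply, Fin.sum_univ_two, Matrix.SpecialLinearGroup.coe_one, Matrix.neg_apply,
      Matrix.one_apply_eq, Matrix.one_apply_ne, ne_eq, zero_ne_one, one_ne_zero,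
      not_false_eq_true] at e00 e01 e10 e11
    have htr : δ 0 0 + δ 1 1 = 0 := by
      linear_combination (γ 1 1 * e00 - γ 1 0 * e01 - γ 0 1 * e10 + γ 0 0 * e11) / 2 -
        (δ 0 0 + δ 1 1) * hγ
    rw [htr] at hδ
    norm_num at hδ

/-- Commuting elements have proportional traceless parts, hence proportional quadratic polynomials
`c z² + (d - a) z - b`. -/
theorem exists_displacement_eq_mul_of_commute {γ δ : SL(2, ℝ)} (h : γ * δ = δ * γ)
    (hγ : displacement γ UpperHalfPlane.I ≠ 0) :
    ∃ β : ℝ, ∀ w : ℍ, displacement δ w = β ^ 2 * displacement γ w := by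
  have e (i j : Fin 2) : (γ * δ) i j = (δ * γ) i j := by rw [h]
  have e00 := e 0 0
  have e01 := e 0 1
  have e10 := e 1 0
  simp only [Matrix.SpecialLinearGroup.coe_mul, Matrix.mul_apply, Fin.sum_univ_two]
    at e00 e01 e10
  obtain ⟨β, hb, hc, had⟩ : ∃ β, δ 0 1 = β * γ 0 1 ∧ δ 1 0 = β * γ 1 0 ∧
      δ 1 1 - δ 0 0 = β * (γ 1 1 - γ 0 0) := by
    by_cases hc : γ 1 0 = 0
    · by_cases hb : γ 0 1 = 0
      · have had : γ 1 1 - γ 0 0 ≠ 0 := by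
          intro had
          rw [displacement_I, hc, hb, ← neg_sub, had] at hγ
          norm_num at hγ
        refine ⟨(δ 1 1 - δ 0 0) / (γ 1 1 - γ 0 0), ?_, ?_, (div_mul_cancel₀ _ had).symm⟩
        · rw [hb] at e01 ⊢
          refine (mul_eq_zero.1 ?_).resolve_right had |>.trans (mul_zero _).symm
          linear_combination -e01
        · rw [hc] at e10 ⊢
          refine (mul_eq_zero.1 ?_).resolve_right had |>.trans (mul_zero _).symm
          linear_combination e10
      · refine ⟨δ 0 1 / γ 0 1, (div_mul_cancel₀ _ hb).symm, ?_, ?_⟩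
        · field_simp; linear_combination e00
        · field_simp; linear_combination e01
    · refine ⟨δ 1 0 / γ 1 0, ?_, (div_mul_cancel₀ _ hc).symm, ?_⟩
      · field_simp; linear_combination -e00
      · field_simp; linear_combination -e10
  refine ⟨β, fun w => ?_⟩
  rw [displacement_eq, displacement_eq, hb, hc, had]
  ring

theorem four_le_trace_sq {γ : SL(2, ℝ)} (h : ∀ z : ℍ, γ • z ≠ z) :
    4 ≤ (γ 0 0 + γ 1 1) ^ 2 := by
  by_contra! hlt
  obtain ⟨z, hz⟩ := exists_fixedPoint_of_trace_sq_lt γ hlt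
  exact h z hz

theorem dist_I_le {w : ℍ} {r : ℝ} (hr : 0 ≤ r) (hw : 81 / 100 ≤ w.im)
    (h : w.re ^ 2 + (w.im - 1) ^ 2 ≤ (9 / 10 * r) ^ 2) : dist UpperHalfPlane.I w ≤ r := by
  refine (UpperHalfPlane.dist_le_dist_coe_div_sqrt _ _).trans ?_
  have h1 : (9 / 10 : ℝ) ≤ √(UpperHalfPlane.I.im * w.im) := by
    apply Real.le_sqrt_of_sq_le
    rw [UpperHalfPlane.I_im]
    linarith
  have h2 : dist (UpperHalfPlane.I : ℂ) w ≤ 9 / 10 * r := by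
    rw [Complex.dist_eq_re_im]
    refine Real.sqrt_le_iff.2 ⟨by positivity, le_of_eq_of_le ?_ h⟩
    simp
    ring
  rw [div_le_iff₀ (by linarith)]
  nlinarith

/-- The displacement has no local maximum, quantitatively at `i`. It grows at one of four points
around `i`, two on a horizontal and two on the vertical line: with weights `1, 1, 2, 2`, the
increases at `i ± x`, `i v` and `i / v` with `v - 1 / v ≥ x` add up to a positive definite
quadratic form in `b`, `c` and `d - a`. -/
theorem exists_displacement_gain (γ : SL(2, ℝ)) : ∃ w : ℍ, dist UpperHalfPlane.I w ≤ 1 / 60 ∧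
    (1 + 1 / 100000) * displacement γ UpperHalfPlane.I ≤ displacement γ w := by
  let w₁ : ℍ := ⟨⟨1 / 80, 1⟩, one_pos⟩
  let w₂ : ℍ := ⟨⟨-1 / 80, 1⟩, one_pos⟩
  let w₃ : ℍ := ⟨⟨0, 101 / 100⟩, by norm_num⟩
  let w₄ : ℍ := ⟨⟨0, 100 / 101⟩, by norm_num⟩
  by_contra! H
  have h₁ := H w₁ (dist_I_le (by norm_num) (by norm_num [w₁, UpperHalfPlane.im])
    (by norm_num [w₁, UpperHalfPlane.im, UpperHalfPlane.re]))
  have h₂ := H w₂ (dist_I_le (by norm_num) (by norm_num [w₂, UpperHalfPlane.im])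
    (by norm_num [w₂, UpperHalfPlane.im, UpperHalfPlane.re]))
  have h₃ := H w₃ (dist_I_le (by norm_num) (by norm_num [w₃, UpperHalfPlane.im])
    (by norm_num [w₃, UpperHalfPlane.im, UpperHalfPlane.re]))
  have h₄ := H w₄ (dist_I_le (by norm_num) (by norm_num [w₄, UpperHalfPlane.im])
    (by norm_num [w₄, UpperHalfPlane.im, UpperHalfPlane.re]))
  rw [displacement_I, displacement_eq] at h₁ h₂ h₃ h₄
  simp only [UpperHalfPlane.im, UpperHalfPlane.re, w₁, w₂, w₃, w₄] at h₁ h₂ h₃ h₄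
  clear H
  generalize γ 0 0 = a, γ 0 1 = b, γ 1 0 = c, γ 1 1 = d at *
  obtain ⟨u, hu⟩ : ∃ u, u = d - a := ⟨_, rfl⟩
  rw [← hu, show (a - d) ^ 2 = u ^ 2 by rw [hu]; ring] at h₁ h₂ h₃ h₄
  ring_nf at h₁ h₂ h₃ h₄
  nlinarith [sq_nonneg u, sq_nonneg (b + 3 * c), sq_nonneg (b - c), sq_nonneg c, sq_nonneg b]

theorem cosh_le_of_abs_lt {x : ℝ} {r : ℝ} (hx : |x| ≤ r) (hr : r ^ 2 / 2 < 1) :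
    Real.cosh x ≤ 1 / (1 - r ^ 2 / 2) := by
  refine (Real.cosh_le_exp_half_sq x).trans ?_
  have : x ^ 2 ≤ r ^ 2 := sq_le_sq' (by linarith [neg_abs_le x]) (by linarith [le_abs_self x])
  refine (Real.exp_le_exp.2 (by linarith)).trans (Real.exp_bound_div_one_sub_of_interval
    (by positivity) hr)

theorem displacement_le_of_dist_le {γ : SL(2, ℝ)} {z : ℍ} {r : ℝ} (h : dist z (γ • z) ≤ r)
    (hr : r ^ 2 / 2 < 1) : displacement γ z ≤ (1 / (1 - r ^ 2 / 2) - 1) / 2 := by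
  have := cosh_le_of_abs_lt ((abs_of_nonneg dist_nonneg).trans_le h) hr
  rw [cosh_dist_eq] at this
  linarith

theorem le_displacement_of_le_dist {γ : SL(2, ℝ)} {z : ℍ} {r : ℝ} (hr : 0 ≤ r)
    (h : r ≤ dist z (γ • z)) : (r / 2) ^ 2 ≤ displacement γ z := by
  refine pow_le_pow_left₀ (by linarith) ?_ 2
  have h1 : dist z (γ • z) / 2 ≤ Real.sinh (dist z (γ • z) / 2) :=
    Real.self_le_sinh_iff.2 (by positivity)
  linarith

theorem displacement_conj (g γ : SL(2, ℝ)) (z : ℍ) :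
    displacement (g * γ * g⁻¹) (g • z) = displacement γ z := by
  rw [displacement, displacement, mul_smul, mul_smul, inv_smul_smul, dist_smul]

theorem dist_sub_le_dist_smul (γ : SL(2, ℝ)) (z w : ℍ) :
    dist z (γ • z) - 2 * dist z w ≤ dist w (γ • w) := by
  have h1 := dist_triangle4 z w (γ • w) (γ • z)
  rw [dist_smul, dist_comm w z] at h1
  linarith

/-- Improvement of a lower bound for all displacements by a fixed factor, from `i` to a point
nearby. -/
theorem exists_displacement_ge_I {Γ : Subgroup SL(2, ℝ)}
    (hfix : ∀ γ ∈ Γ, γ ≠ 1 → γ ≠ -1 → ∀ z : ℍ, γ • z ≠ z)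
    (hshort : ∃ γ ∈ Γ, γ ≠ 1 ∧ γ ≠ -1 ∧ dist UpperHalfPlane.I (γ • UpperHalfPlane.I) < 0.26)
    {m : ℝ} (hm : 0 < m)
    (hle : ∀ γ ∈ Γ, γ ≠ 1 → γ ≠ -1 → m ≤ displacement γ UpperHalfPlane.I) :
    ∃ w : ℍ, ∀ γ ∈ Γ, γ ≠ 1 → γ ≠ -1 → (1 + 1 / 1000000) * m ≤ displacement γ w := by
  by_cases hall : ∀ γ ∈ Γ, γ ≠ 1 → γ ≠ -1 →
      (1 + 1 / 1000000) * m ≤ displacement γ UpperHalfPlane.I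
  · exact ⟨_, hall⟩
  push Not at hall
  obtain ⟨γ, hγ, hγ1, hγ1', hγm⟩ := hall
  obtain ⟨σ, hσ, hσ1, hσ1', hσd⟩ := hshort
  have hm' : m ≤ 0.0175 :=
    (hle σ hσ hσ1 hσ1').trans
      ((displacement_le_of_dist_le hσd.le (by norm_num)).trans (by norm_num))
  have hγpos : 0 < displacement γ UpperHalfPlane.I := hm.trans_le (hle γ hγ hγ1 hγ1')
  have hγd : dist UpperHalfPlane.I (γ • UpperHalfPlane.I) < 0.3 := by
    by_contra! h
    have := le_displacement_of_le_dist (by norm_num) h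
    linarith
  obtain ⟨w, hw, hgain⟩ := exists_displacement_gain γ
  refine ⟨w, fun δ hδ hδ1 hδ1' => ?_⟩
  -- an element that moves `i` by at least `0.3` moves `w` by at least `0.3 - 2 / 60 > 0.26`; any
  -- other one commutes with `γ`
  rcases le_or_gt 0.3 (dist UpperHalfPlane.I (δ • UpperHalfPlane.I)) with hδd | hδd
  · have h1 := dist_sub_le_dist_smul δ UpperHalfPlane.I w
    have h2 := le_displacement_of_le_dist (z := w) (γ := δ) (r := 0.3 - 2 / 60)
      (by norm_num) (by linarith)
    norm_num at h2
    linarith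
  · have htrγ := four_le_trace_sq (hfix γ hγ hγ1 hγ1')
    have htrδ := four_le_trace_sq (hfix δ hδ hδ1 hδ1')
    have hprod : dist UpperHalfPlane.I ((δ * γ) • UpperHalfPlane.I) ≤ 0.6 := by
      have := dist_triangle UpperHalfPlane.I (δ • UpperHalfPlane.I) ((δ * γ) • UpperHalfPlane.I)
      rw [mul_smul, dist_smul] at this
      rw [mul_smul]
      linarith
    have hcomm : γ * δ = δ * γ := by
      refine commute_of_commutator_eq_one_or_neg_one htrδ ?_
      -- otherwise the commutator has displacement at least `m`, but `32 * 0.0236 * 1.22 < 1` is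
      -- small enough to bring its displacement below `m`
      by_contra! hne
      have h1 := hle _ (Γ.mul_mem (Γ.mul_mem (Γ.mul_mem hγ hδ) (Γ.inv_mem hγ)) (Γ.inv_mem hδ))
        hne.1 hne.2
      have h2 := displacement_commutator_I_le γ δ htrγ htrδ
      have h3 : displacement δ UpperHalfPlane.I ≤ 0.0236 :=
        (displacement_le_of_dist_le hδd.le (by norm_num)).trans (by norm_num)
      have h4 : Real.cosh (dist UpperHalfPlane.I ((δ * γ) • UpperHalfPlane.I)) ≤ 1.22 :=
        (cosh_le_of_abs_lt ((abs_of_nonneg dist_nonneg).trans_le hprod) (by norm_num)).trans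
          (by norm_num)
      have h5 : 32 * displacement γ UpperHalfPlane.I * displacement δ UpperHalfPlane.I *
          Real.cosh (dist UpperHalfPlane.I ((δ * γ) • UpperHalfPlane.I)) ≤
          32 * displacement γ UpperHalfPlane.I * 0.0236 * 1.22 := by gcongr
      linarith
    obtain ⟨β, hβ⟩ := exists_displacement_eq_mul_of_commute hcomm hγpos.ne'
    have h1 := hle δ hδ hδ1 hδ1'
    rw [hβ] at h1 ⊢
    have h2 := mul_le_mul_of_nonneg_left hgain (sq_nonneg β)
    linarith

/-- Improvement of a lower bound for all displacements by a fixed factor, from `z` to another point: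
`exists_displacement_ge_I` for the group conjugated by an element that takes `i` to `z`. -/
theorem exists_displacement_ge {Γ : Subgroup SL(2, ℝ)}
    (hfix : ∀ γ ∈ Γ, γ ≠ 1 → γ ≠ -1 → ∀ z : ℍ, γ • z ≠ z) {z : ℍ}
    (hshort : ∃ γ ∈ Γ, γ ≠ 1 ∧ γ ≠ -1 ∧ dist z (γ • z) < 0.26) {m : ℝ} (hm : 0 < m)
    (hle : ∀ γ ∈ Γ, γ ≠ 1 → γ ≠ -1 → m ≤ displacement γ z) :
    ∃ w : ℍ, ∀ γ ∈ Γ, γ ≠ 1 → γ ≠ -1 → (1 + 1 / 1000000) * m ≤ displacement γ w := by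
  obtain ⟨g, rfl⟩ := MulAction.exists_smul_eq SL(2, ℝ) UpperHalfPlane.I z
  have hne {γ : SL(2, ℝ)} (h : γ ≠ 1) : g * γ * g⁻¹ ≠ 1 := by
    rwa [ne_eq, mul_inv_eq_one, mul_eq_left]
  have hne' {γ : SL(2, ℝ)} (h : γ ≠ -1) : g * γ * g⁻¹ ≠ -1 := by
    rwa [ne_eq, mul_inv_eq_iff_eq_mul, neg_one_mul, ← mul_neg_one, mul_right_inj]
  have hc (γ : SL(2, ℝ)) : g * (g⁻¹ * γ * g) * g⁻¹ = γ := by group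
  have key : ∃ w : ℍ, ∀ γ ∈ Γ.comap (MulAut.conj g).toMonoidHom, γ ≠ 1 → γ ≠ -1 →
      (1 + 1 / 1000000) * m ≤ displacement γ w := by
    refine exists_displacement_ge_I (fun γ hγ h1 h1' z hz => ?_) ?_ hm fun γ hγ h1 h1' => ?_
    · refine hfix _ hγ (hne h1) (hne' h1') (g • z) ?_
      simp [mul_smul, hz]
    · obtain ⟨γ, hγ, h1, h1', hd⟩ := hshort
      refine ⟨g⁻¹ * γ * g, ?_, fun h => h1 ?_, fun h => h1' ?_, ?_⟩
      · simpa [Subgroup.mem_comap, hc] using hγ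
      · rw [← hc γ, h]; simp
      · rw [← hc γ, h]; simp
      · rwa [mul_smul, mul_smul, ← dist_smul g, smul_inv_smul]
    · rw [← displacement_conj g]
      exact hle _ hγ (hne h1) (hne' h1')
  obtain ⟨w, hw⟩ := key
  refine ⟨g • w, fun γ hγ h1 h1' => ?_⟩
  rw [← hc γ, displacement_conj]
  refine hw _ (by simpa [Subgroup.mem_comap, hc] using hγ) (fun h => h1 ?_) (fun h => h1' ?_)
  · rw [← hc γ, h]; simp
  · rw [← hc γ, h]; simp

/-- The Margulis lemma in the form needed here: if the elements of `Γ` other than `±1` move all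
points by at least some `ε > 0`, then there is a point that they all move by at least `0.26`. -/
theorem exists_forall_dist_smul_ge {Γ : Subgroup SL(2, ℝ)} {ε : ℝ} (hε : 0 < ε)
    (hdist : ∀ γ ∈ Γ, γ ≠ 1 → γ ≠ -1 → ∀ z : ℍ, ε ≤ dist z (γ • z)) :
    ∃ z : ℍ, ∀ γ ∈ Γ, γ ≠ 1 → γ ≠ -1 → 0.26 ≤ dist z (γ • z) := by
  by_contra! H
  have hfix : ∀ γ ∈ Γ, γ ≠ 1 → γ ≠ -1 → ∀ z : ℍ, γ • z ≠ z := fun γ hγ h1 h1' z hz => by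
    have := hdist γ hγ h1 h1' z
    rw [hz, dist_self] at this
    linarith
  have hgrow (n : ℕ) : ∃ z : ℍ, ∀ γ ∈ Γ, γ ≠ 1 → γ ≠ -1 →
      (1 + 1 / 1000000) ^ n * (ε / 2) ^ 2 ≤ displacement γ z := by
    induction n with
    | zero =>
      refine ⟨UpperHalfPlane.I, fun γ hγ h1 h1' => ?_⟩
      rw [pow_zero, one_mul]
      exact le_displacement_of_le_dist hε.le (hdist γ hγ h1 h1' _)
    | succ n ih =>
      obtain ⟨z, hz⟩ := ih
      obtain ⟨w, hw⟩ := exists_displacement_ge hfix (H z) (by positivity) hz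
      exact ⟨w, fun γ hγ h1 h1' => by simpa only [pow_succ', mul_assoc] using hw γ hγ h1 h1'⟩
  obtain ⟨n, hn⟩ := pow_unbounded_of_one_lt (1 / (ε / 2) ^ 2)
    (show (1 : ℝ) < 1 + 1 / 1000000 by norm_num)
  rw [div_lt_iff₀ (by positivity)] at hn
  obtain ⟨z, hz⟩ := hgrow n
  obtain ⟨γ, hγ, h1, h1', hd⟩ := H z
  have := hz γ hγ h1 h1'
  have := displacement_le_of_dist_le hd.le (by norm_num)
  norm_num at this
  linarith

/-! ### Möbius transformations that agree near a point -/

theorem eq_one_or_eq_neg_one_of_eventually_smul_eq {γ : SL(2, ℝ)} {z : ℍ}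
    (h : ∀ᶠ w in 𝓝 z, γ • w = w) : γ = 1 ∨ γ = -1 := by
  have hdisp : ∀ w : ℍ, γ • w = w → 2 * γ 1 0 * w.re + (γ 1 1 - γ 0 0) = 0 ∧
      γ 1 0 * (w.re ^ 2 - w.im ^ 2) + (γ 1 1 - γ 0 0) * w.re - γ 0 1 = 0 := by
    intro w hw
    have h0 : displacement γ w = 0 := by simp [displacement, hw]
    have hy := w.im_pos
    rw [displacement_eq, div_eq_zero_iff, or_iff_left (by positivity)] at h0
    have h1 := (add_eq_zero_iff_of_nonneg (sq_nonneg _) (sq_nonneg _)).1 h0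
    refine ⟨?_, by simpa using h1.1⟩
    have h2 := (sq_eq_zero_iff.1 h1.2)
    have h3 : (2 * γ 1 0 * w.re + (γ 1 1 - γ 0 0)) * w.im = 0 := by linear_combination h2
    exact (mul_eq_zero.1 h3).resolve_right hy.ne'
  have hcont : Filter.Tendsto (fun t : ℝ => t +ᵥ z) (𝓝 0) (𝓝 z) := by
    have : Continuous fun t : ℝ => t +ᵥ z := by
      rw [UpperHalfPlane.isEmbedding_coe.continuous_iff]
      simp only [Function.comp_def, UpperHalfPlane.coe_vadd]
      fun_prop
    simpa using this.tendsto 0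
  obtain ⟨t, ht, ht0⟩ := (((hcont.eventually h).filter_mono nhdsWithin_le_nhds).and
    self_mem_nhdsWithin : ∀ᶠ t in 𝓝[≠] (0 : ℝ), γ • (t +ᵥ z) = t +ᵥ z ∧ t ∈ ({0}ᶜ : Set ℝ)).exists
  obtain ⟨h1, h2⟩ := hdisp z h.self_of_nhds
  obtain ⟨h3, -⟩ := hdisp _ ht
  have hc : γ 1 0 = 0 := by
    rw [UpperHalfPlane.vadd_re] at h3
    have : t * γ 1 0 = 0 := by linear_combination (h3 - h1) / 2
    exact (mul_eq_zero.1 this).resolve_left ht0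
  rw [hc] at h1 h2
  have hd : γ 1 1 = γ 0 0 := by linarith
  have hb : γ 0 1 = 0 := by rw [hd] at h2; linarith
  have hdet := det_eq γ
  rw [hb, hd, hc] at hdet
  have ha : γ 0 0 = 1 ∨ γ 0 0 = -1 := mul_self_eq_one_iff.1 (by linarith)
  refine ha.imp (fun ha => ?_) fun ha => ?_ <;>
  · ext i j
    fin_cases i <;> fin_cases j <;> simp [ha, hb, hc, hd]

theorem neg_smul_eq_smul (γ : SL(2, ℝ)) (w : ℍ) : (-γ) • w = γ • w := by
  rw [UpperHalfPlane.ext_iff, UpperHalfPlane.coe_specialLinearGroup_apply,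
    UpperHalfPlane.coe_specialLinearGroup_apply]
  simp only [Matrix.SpecialLinearGroup.coe_neg, Matrix.neg_apply, map_neg,
    Complex.ofReal_neg, neg_mul, ← neg_add, neg_div_neg_eq]

theorem smul_eq_smul_of_eventually {γ δ : SL(2, ℝ)} {z : ℍ}
    (h : ∀ᶠ w in 𝓝 z, γ • w = δ • w) (w : ℍ) : γ • w = δ • w := by
  have h1 : δ⁻¹ * γ = 1 ∨ δ⁻¹ * γ = -1 := by
    refine eq_one_or_eq_neg_one_of_eventually_smul_eq (z := z) ?_
    filter_upwards [h] with w hw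
    rw [mul_smul, hw, inv_smul_smul]
  rcases h1 with h1 | h1
  · rw [inv_mul_eq_one.1 h1]
  · rw [inv_mul_eq_iff_eq_mul, mul_neg_one] at h1
    rw [h1, neg_smul_eq_smul]

/-! ### Geodesics and discs in the hyperbolic plane -/

/-- A rotation about `i` takes `u` to the imaginary axis. The real part of the image changes sign
between the rotation by angle `0` and `z ↦ -1 / z`, so it vanishes in between. -/
theorem exists_rotation_re_eq_zero (u : ℍ) :
    ∃ k : SL(2, ℝ), k • UpperHalfPlane.I = UpperHalfPlane.I ∧ (k • u).re = 0 := by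
  obtain ⟨θ, hθ⟩ : ∃ θ : ℝ, Real.cos θ * Real.sin θ * (1 - (u.re ^ 2 + u.im ^ 2)) +
      (Real.cos θ ^ 2 - Real.sin θ ^ 2) * u.re = 0 := by
    let F : ℝ → ℝ := fun θ => Real.cos θ * Real.sin θ * (1 - (u.re ^ 2 + u.im ^ 2)) +
      (Real.cos θ ^ 2 - Real.sin θ ^ 2) * u.re
    have hF : Continuous F := by fun_prop
    have h0 : F 0 = u.re := by simp [F]
    have h1 : F (Real.pi / 2) = -u.re := by simp [F]
    have : (0 : ℝ) ∈ Set.uIcc (F 0) (F (Real.pi / 2)) := by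
      rw [h0, h1, Set.mem_uIcc]
      rcases le_total u.re 0 with h | h
      · left; constructor <;> linarith
      · right; constructor <;> linarith
    obtain ⟨θ, -, h⟩ := intermediate_value_uIcc hF.continuousOn this
    exact ⟨θ, h⟩
  have hcs := Real.cos_sq_add_sin_sq θ
  generalize Real.cos θ = c, Real.sin θ = s at hθ hcs
  let k : SL(2, ℝ) := ⟨!![c, s; -s, c], by
    rw [Matrix.det_fin_two_of]; linarith⟩
  refine ⟨k, ?_, ?_⟩
  · refine (dist_eq_zero.1 ?_).symm
    have : displacement k UpperHalfPlane.I = 0 := by rw [displacement_I]; simp [k]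
    rw [displacement, sq_eq_zero_iff, Real.sinh_eq_zero] at this
    linarith
  · rw [← UpperHalfPlane.coe_re, UpperHalfPlane.coe_specialLinearGroup_apply, Complex.div_re,
      ← add_div, div_eq_zero_iff]
    left
    simp [k]
    linear_combination hθ

/-- A point on the geodesic from `i` to `u` at distance `r` from `i`. -/
theorem exists_dist_eq_of_le (u : ℍ) {r : ℝ} (hr : 0 ≤ r) (hru : r ≤ dist UpperHalfPlane.I u) :
    ∃ w : ℍ, dist UpperHalfPlane.I w = r ∧ dist w u = dist UpperHalfPlane.I u - r := by
  obtain ⟨k, hkI, hk⟩ := exists_rotation_re_eq_zero u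
  obtain ⟨v, hv⟩ : ∃ v, v = k • u := ⟨_, rfl⟩
  rw [← hv] at hk
  have hd : dist UpperHalfPlane.I u = |Real.log v.im| := by
    rw [← dist_smul k, hkI, ← hv, UpperHalfPlane.dist_of_re_eq (by simp [hk]), Real.dist_eq]
    simp
  rw [hd] at hru ⊢
  have key (s : ℝ) : ∃ w : ℍ, dist UpperHalfPlane.I w = |s| ∧ dist w u = |s - Real.log v.im| := by
    let p : ℍ := ⟨⟨0, Real.exp s⟩, Real.exp_pos s⟩
    have hp : p.im = Real.exp s := rfl
    have hp' : p.re = 0 := rfl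
    refine ⟨k⁻¹ • p, ?_, ?_⟩
    · rw [← dist_smul k, hkI, smul_inv_smul, UpperHalfPlane.dist_of_re_eq (by simp [hp']), hp,
        Real.log_exp, Real.dist_eq]
      simp
    · rw [← dist_smul k, smul_inv_smul, ← hv, UpperHalfPlane.dist_of_re_eq (by rw [hk, hp']), hp,
        Real.log_exp, Real.dist_eq]
  rcases le_total 0 (Real.log v.im) with h | h
  · obtain ⟨w, h1, h2⟩ := key r
    rw [abs_of_nonneg h] at hru ⊢
    refine ⟨w, by rwa [abs_of_nonneg hr] at h1, ?_⟩
    rw [h2, abs_sub_comm, abs_of_nonneg (by linarith)]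
  · obtain ⟨w, h1, h2⟩ := key (-r)
    rw [abs_of_nonpos h] at hru ⊢
    refine ⟨w, by rwa [abs_neg, abs_of_nonneg hr] at h1, ?_⟩
    rw [h2, abs_of_nonneg (by linarith)]
    ring

/-- Connectedness of a set that is convex in the Euclidean sense. -/
theorem isPreconnected_of_convex_image {s : Set ℍ} (h : Convex ℝ ((↑) '' s : Set ℂ)) :
    IsPreconnected s :=
  UpperHalfPlane.isEmbedding_coe.isInducing.isPreconnected_image.1 h.isPreconnected

theorem convex_image_coe_ball (z : ℍ) (r : ℝ) : Convex ℝ ((↑) '' Metric.ball z r : Set ℂ) := by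
  rw [UpperHalfPlane.image_coe_ball]
  exact convex_ball _ _

theorem isPreconnected_ball (z : ℍ) (r : ℝ) : IsPreconnected (Metric.ball z r) :=
  isPreconnected_of_convex_image (convex_image_coe_ball z r)

theorem isPreconnected_ball_inter_ball (z w : ℍ) (r s : ℝ) :
    IsPreconnected (Metric.ball z r ∩ Metric.ball w s) := by
  refine isPreconnected_of_convex_image ?_
  rw [Set.image_inter UpperHalfPlane.coe_injective]
  exact (convex_image_coe_ball z r).inter (convex_image_coe_ball w s)

/-! ### Oriented local isometries into a hyperbolic surface -/

section LocalIsometry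

variable {M : Type*} [TopologicalSpace M] [ChartedSpace ℍ M]

/-- Near `z`, the map `f` read in some chart of `M` is a Möbius transformation by an element of
`SL(2, ℝ)`. The chart may be any chart of the atlas; `exists_eventually_eq_smul` shows that every
chart around `f z` does. -/
def IsOrientedLocalIsometryAt (f : ℍ → M) (z : ℍ) : Prop :=
  ∃ e ∈ atlas ℍ M, ∃ γ : SL(2, ℝ), ∀ᶠ w in 𝓝 z, f w ∈ e.source ∧ e (f w) = γ • w

namespace IsOrientedLocalIsometryAt

variable {f g : ℍ → M} {z : ℍ}

theorem congr (hf : IsOrientedLocalIsometryAt f z) (h : f =ᶠ[𝓝 z] g) :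
    IsOrientedLocalIsometryAt g z := by
  obtain ⟨e, he, γ, hγ⟩ := hf
  refine ⟨e, he, γ, ?_⟩
  filter_upwards [hγ, h] with w hw h'
  rwa [← h']

theorem comp_smul {γ : SL(2, ℝ)} (hf : IsOrientedLocalIsometryAt f (γ • z)) :
    IsOrientedLocalIsometryAt (fun w => f (γ • w)) z := by
  obtain ⟨e, he, δ, hδ⟩ := hf
  refine ⟨e, he, δ * γ, ?_⟩
  filter_upwards [(isometry_smul ℍ γ).continuous.continuousAt.eventually hδ] with w hw
  rwa [mul_smul]

theorem symm_smul {e : OpenPartialHomeomorph M ℍ} (he : e ∈ atlas ℍ M) {γ : SL(2, ℝ)}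
    (hz : γ • z ∈ e.target) : IsOrientedLocalIsometryAt (fun w => e.symm (γ • w)) z := by
  refine ⟨e, he, γ, ?_⟩
  filter_upwards [(isometry_smul ℍ γ).continuous.continuousAt.eventually
    (e.open_target.mem_nhds hz)] with w hw
  exact ⟨e.map_target hw, e.right_inv hw⟩

theorem continuousAt (hf : IsOrientedLocalIsometryAt f z) : ContinuousAt f z := by
  obtain ⟨e, -, γ, hγ⟩ := hf
  have hz := hγ.self_of_nhds
  have h : (fun w => e.symm (γ • w)) =ᶠ[𝓝 z] f := by
    filter_upwards [hγ] with w hw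
    rw [← hw.2, e.left_inv hw.1]
  refine ContinuousAt.congr (ContinuousAt.comp (f := fun w => γ • w) (g := e.symm) ?_
    (isometry_smul ℍ γ).continuous.continuousAt) h
  exact e.symm.continuousAt (by rw [← hz.2]; exact e.map_source hz.1)

/-- The chart in the definition of an oriented local isometry can be replaced by any other chart
around `f z`, since the transition maps are Möbius transformations locally. -/
theorem exists_eventually_eq_smul [HasGroupoid M hyperbolicGroupoid]
    (hf : IsOrientedLocalIsometryAt f z) {e : OpenPartialHomeomorph M ℍ} (he : e ∈ atlas ℍ M)
    (hz : f z ∈ e.source) :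
    ∃ γ : SL(2, ℝ), ∀ᶠ w in 𝓝 z, f w ∈ e.source ∧ e (f w) = γ • w := by
  have hcont := hf.continuousAt
  obtain ⟨e', he', γ, hγ⟩ := hf
  have h0 := hγ.self_of_nhds
  have hmem : e'.symm ≫ₕ e ∈ hyperbolicGroupoid := HasGroupoid.compatible he' he
  obtain ⟨δ, hδ⟩ := hmem.1 (e' (f z)) (by
    rw [OpenPartialHomeomorph.trans_source, OpenPartialHomeomorph.symm_source]
    refine ⟨e'.map_source h0.1, ?_⟩
    rwa [Set.mem_preimage, e'.left_inv h0.1])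
  rw [h0.2] at hδ
  refine ⟨δ * γ, ?_⟩
  filter_upwards [hγ, (isometry_smul ℍ γ).continuous.continuousAt.eventually hδ,
    hcont.eventually (e.open_source.mem_nhds hz)] with w h1 h2 h3
  refine ⟨h3, ?_⟩
  rw [mul_smul, ← h2, ← h1.2, OpenPartialHomeomorph.coe_trans, Function.comp_apply,
    e'.left_inv h1.1]

end IsOrientedLocalIsometryAt

/-- Identity principle: local isometries with the same germ at one point of a connected set agree on
it. -/
theorem eqOn_of_isPreconnected [HasGroupoid M hyperbolicGroupoid] [T2Space M] {f g : ℍ → M}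
    {s : Set ℍ} (hs : IsPreconnected s) (hf : ∀ z ∈ s, IsOrientedLocalIsometryAt f z)
    (hg : ∀ z ∈ s, IsOrientedLocalIsometryAt g z) {z₀ : ℍ} (hz₀ : z₀ ∈ s)
    (h : f =ᶠ[𝓝 z₀] g) : Set.EqOn f g s := by
  let U : Set ℍ := {z | f =ᶠ[𝓝 z] g}
  have hU : IsOpen U := isOpen_iff_mem_nhds.2 fun z hz => eventually_eventually_nhds.2 hz
  have hsub : s ⊆ U := by
    refine hs.subset_of_closure_inter_subset hU ⟨z₀, hz₀, h⟩ ?_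
    rintro z ⟨hzU, hzs⟩
    have hfreq : ∃ᶠ w in 𝓝 z, w ∈ U := mem_closure_iff_frequently.1 hzU
    have hz : f z = g z := by
      by_contra hne
      have hne' := ((hf z hzs).continuousAt.ne_iff_eventually_ne (hg z hzs).continuousAt).1 hne
      obtain ⟨w, hw, hw'⟩ := (hfreq.and_eventually hne').exists
      exact hw' hw.self_of_nhds
    obtain ⟨γ, hγ⟩ := (hf z hzs).exists_eventually_eq_smul (chart_mem_atlas ℍ (f z))
      (mem_chart_source ℍ (f z))
    obtain ⟨δ, hδ⟩ := (hg z hzs).exists_eventually_eq_smul (chart_mem_atlas ℍ (f z))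
      (hz ▸ mem_chart_source ℍ (f z))
    obtain ⟨w, hw, hγw, hδw⟩ := (hfreq.and_eventually
      ((eventually_eventually_nhds.2 hγ).and (eventually_eventually_nhds.2 hδ))).exists
    have heq := smul_eq_smul_of_eventually (z := w) (γ := γ) (δ := δ) (by
      filter_upwards [hw, hγw, hδw] with v h1 h2 h3
      rw [← h2.2, ← h3.2, h1])
    change ∀ᶠ w in 𝓝 z, f w = g w
    filter_upwards [hγ, hδ] with v h1 h2
    exact (chartAt ℍ (f z)).injOn h1.1 h2.1 (by rw [h1.2, h2.2, heq])
  exact fun z hz => (hsub hz).self_of_nhds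

/-- On a compact surface, every germ of an oriented local isometry extends to a disc of a uniform
radius `ε`, and is injective there: `ε` is a Lebesgue number of a finite cover by charts. -/
theorem exists_uniform_extension [HasGroupoid M hyperbolicGroupoid] [CompactSpace M] :
    ∃ ε > 0, ∀ (f : ℍ → M) (w : ℍ), IsOrientedLocalIsometryAt f w →
      ∃ g : ℍ → M, (∀ z ∈ Metric.ball w ε, IsOrientedLocalIsometryAt g z) ∧
        Set.InjOn g (Metric.ball w ε) ∧ f =ᶠ[𝓝 w] g := by
  have hr (q : M) : ∃ r > 0, Metric.ball (chartAt ℍ q q) (2 * r) ⊆ (chartAt ℍ q).target := by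
    obtain ⟨r, hr, h⟩ := Metric.isOpen_iff.1 (chartAt ℍ q).open_target _
      (mem_chart_target ℍ q)
    exact ⟨r / 2, by positivity, by rwa [mul_div_cancel₀ _ two_ne_zero]⟩
  choose r hr hball using hr
  let U (q : M) : Set M := (chartAt ℍ q).source ∩ chartAt ℍ q ⁻¹' Metric.ball (chartAt ℍ q q) (r q)
  have hU (q : M) : IsOpen (U q) :=
    (chartAt ℍ q).isOpen_inter_preimage Metric.isOpen_ball
  obtain ⟨t, ht⟩ := isCompact_univ.elim_finite_subcover U hU fun q _ =>
    Set.mem_iUnion.2 ⟨q, mem_chart_source ℍ q, Metric.mem_ball_self (hr q)⟩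
  obtain ⟨ε, hε, hεr⟩ : ∃ ε > 0, ∀ q ∈ t, ε ≤ r q := by
    rcases t.eq_empty_or_nonempty with rfl | hne
    · exact ⟨1, one_pos, by simp⟩
    · obtain ⟨q, -, hq⟩ := t.exists_min_image r hne
      exact ⟨r q, hr q, hq⟩
  refine ⟨ε, hε, fun f w hf => ?_⟩
  obtain ⟨q, hqt, hq⟩ : ∃ q ∈ t, f w ∈ U q := by simpa using ht (Set.mem_univ (f w))
  obtain ⟨γ, hγ⟩ := hf.exists_eventually_eq_smul (chart_mem_atlas ℍ q) hq.1
  have hsub : ∀ z ∈ Metric.ball w ε, γ • z ∈ (chartAt ℍ q).target := by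
    intro z hz
    refine hball q ?_
    have h1 := hq.2
    rw [Set.mem_preimage, hγ.self_of_nhds.2, Metric.mem_ball] at h1
    rw [Metric.mem_ball] at hz ⊢
    have h2 := dist_triangle (γ • z) (γ • w) (chartAt ℍ q q)
    rw [dist_smul] at h2
    linarith [hεr q hqt]
  refine ⟨fun z => (chartAt ℍ q).symm (γ • z),
    fun z hz => .symm_smul (chart_mem_atlas ℍ q) (hsub z hz), ?_, ?_⟩
  · intro z hz z' hz' h
    exact smul_left_cancel γ ((chartAt ℍ q).symm.injOn (hsub z hz) (hsub z' hz') h)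
  · filter_upwards [hγ] with z hz
    rw [← hz.2, (chartAt ℍ q).left_inv hz.1]

/-- A local isometry on the disc of radius `R` about `i` extends to the disc of radius `R + ε / 4`,
by gluing its extensions `g w` to the discs of radius `ε` about the points `w` of the smaller disc. -/
theorem exists_extension_ball [HasGroupoid M hyperbolicGroupoid] [T2Space M] {ε : ℝ} (hε : 0 < ε)
    (hext : ∀ (f : ℍ → M) (w : ℍ), IsOrientedLocalIsometryAt f w →
      ∃ g : ℍ → M, (∀ z ∈ Metric.ball w ε, IsOrientedLocalIsometryAt g z) ∧ f =ᶠ[𝓝 w] g)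
    {f : ℍ → M} {R : ℝ} (hR : 0 < R)
    (hf : ∀ z ∈ Metric.ball UpperHalfPlane.I R, IsOrientedLocalIsometryAt f z) :
    ∃ F : ℍ → M, (∀ z ∈ Metric.ball UpperHalfPlane.I (R + ε / 4), IsOrientedLocalIsometryAt F z) ∧
      F =ᶠ[𝓝 UpperHalfPlane.I] f := by
  have hg (w : ℍ) : ∃ g : ℍ → M, w ∈ Metric.ball UpperHalfPlane.I R →
      (∀ z ∈ Metric.ball w ε, IsOrientedLocalIsometryAt g z) ∧ f =ᶠ[𝓝 w] g := by
    by_cases hw : w ∈ Metric.ball UpperHalfPlane.I R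
    · obtain ⟨g, hg⟩ := hext f w (hf w hw)
      exact ⟨g, fun _ => hg⟩
    · exact ⟨f, fun h => absurd h hw⟩
  choose g hg using hg
  have hnear (u : ℍ) : ∃ w : ℍ, u ∈ Metric.ball UpperHalfPlane.I (R + ε / 4) →
      w ∈ Metric.ball UpperHalfPlane.I R ∧ dist u w < ε / 2 := by
    by_cases hu : dist UpperHalfPlane.I u < R
    · exact ⟨u, fun _ => ⟨by rwa [Metric.mem_ball, dist_comm], by rw [dist_self]; positivity⟩⟩
    · obtain ⟨w, hw1, hw2⟩ := exists_dist_eq_of_le u (le_max_left 0 (R - ε / 8))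
        (max_le dist_nonneg (by linarith))
      refine ⟨w, fun hu' => ?_⟩
      rw [Metric.mem_ball, dist_comm] at hu' ⊢
      rw [dist_comm u, hw1, hw2]
      exact ⟨max_lt hR (by linarith), by linarith [le_max_right 0 (R - ε / 8)]⟩
  choose W hW using hnear
  -- two local extensions agree on the intersection of their balls, since the centre of one of
  -- them lies in that intersection and both coincide with `f` there
  have hagree : ∀ w ∈ Metric.ball UpperHalfPlane.I R, ∀ w' ∈ Metric.ball UpperHalfPlane.I R,
      ∀ u, dist u w < ε / 2 → dist u w' < ε / 2 → g w u = g w' u := by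
    intro w hw w' hw' u hu hu'
    have hww' : dist w w' < ε := by linarith [dist_triangle_left w w' u]
    refine eqOn_of_isPreconnected (isPreconnected_ball_inter_ball w w' ε ε)
      (fun z hz => (hg w hw).1 z hz.1) (fun z hz => (hg w' hw').1 z hz.2) (z₀ := w)
      ⟨Metric.mem_ball_self hε, hww'⟩ ?_
      ⟨Metric.mem_ball.2 (by linarith), Metric.mem_ball.2 (by linarith)⟩
    have hfw' : Set.EqOn f (g w') (Metric.ball UpperHalfPlane.I R ∩ Metric.ball w' ε) :=
      eqOn_of_isPreconnected (isPreconnected_ball_inter_ball _ _ _ _) (fun z hz => hf z hz.1)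
        (fun z hz => (hg w' hw').1 z hz.2) (z₀ := w') ⟨hw', Metric.mem_ball_self hε⟩ (hg w' hw').2
    refine (hg w hw).2.symm.trans (hfw'.eventuallyEq_of_mem ?_)
    exact (Metric.isOpen_ball.inter Metric.isOpen_ball).mem_nhds ⟨hw, hww'⟩
  have hF : ∀ w ∈ Metric.ball UpperHalfPlane.I R, ∀ u ∈ Metric.ball UpperHalfPlane.I (R + ε / 4),
      dist u w < ε / 2 → g w =ᶠ[𝓝 u] fun v => g (W v) v := by
    intro w hw u hu huw
    filter_upwards [Metric.isOpen_ball.mem_nhds hu,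
      Metric.isOpen_ball.mem_nhds (Metric.mem_ball.2 huw)] with v hv hvw
    exact hagree _ hw _ (hW v hv).1 _ hvw (hW v hv).2
  refine ⟨fun u => g (W u) u, fun u hu => ?_, ?_⟩
  · obtain ⟨h1, h2⟩ := hW u hu
    exact ((hg _ h1).1 u (Metric.mem_ball.2 (by linarith))).congr (hF _ h1 u hu h2)
  · have hI := Metric.mem_ball_self (x := UpperHalfPlane.I) hR
    exact (hF _ hI _ (Metric.mem_ball_self (by positivity)) (by rw [dist_self]; positivity)).symm
      |>.trans (hg _ hI).2.symm

theorem exists_global_of_extension [HasGroupoid M hyperbolicGroupoid] [T2Space M] {ε : ℝ}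
    (hε : 0 < ε)
    (hext : ∀ (f : ℍ → M) (w : ℍ), IsOrientedLocalIsometryAt f w →
      ∃ g : ℍ → M, (∀ z ∈ Metric.ball w ε, IsOrientedLocalIsometryAt g z) ∧ f =ᶠ[𝓝 w] g)
    {f₀ : ℍ → M} (hf₀ : IsOrientedLocalIsometryAt f₀ UpperHalfPlane.I) :
    ∃ F : ℍ → M, ∀ z, IsOrientedLocalIsometryAt F z := by
  have hn (n : ℕ) : ∃ F : ℍ → M, (∀ z ∈ Metric.ball UpperHalfPlane.I (ε + n * (ε / 4)),
      IsOrientedLocalIsometryAt F z) ∧ F =ᶠ[𝓝 UpperHalfPlane.I] f₀ := by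
    induction n with
    | zero =>
      obtain ⟨g, hg, hfg⟩ := hext f₀ _ hf₀
      exact ⟨g, by simpa using hg, hfg.symm⟩
    | succ n ih =>
      obtain ⟨f, hf, hff₀⟩ := ih
      obtain ⟨F, hF, hFf⟩ := exists_extension_ball hε hext (by positivity) hf
      refine ⟨F, ?_, hFf.trans hff₀⟩
      rwa [Nat.cast_succ, add_one_mul, ← add_assoc]
  choose f hf hff₀ using hn
  have hN (u : ℍ) : ∃ n : ℕ, dist u UpperHalfPlane.I < ε + n * (ε / 4) := by
    obtain ⟨n, hn⟩ := exists_nat_gt (dist u UpperHalfPlane.I / (ε / 4))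
    rw [div_lt_iff₀ (by positivity)] at hn
    exact ⟨n, by linarith⟩
  choose N hN using hN
  have hagree (m n : ℕ) (u : ℍ) (hm : dist u UpperHalfPlane.I < ε + m * (ε / 4))
      (hn : dist u UpperHalfPlane.I < ε + n * (ε / 4)) : f m u = f n u :=
    eqOn_of_isPreconnected (isPreconnected_ball_inter_ball UpperHalfPlane.I UpperHalfPlane.I _ _)
      (fun z hz => hf m z hz.1) (fun z hz => hf n z hz.2) (z₀ := UpperHalfPlane.I)
      ⟨Metric.mem_ball_self (by positivity), Metric.mem_ball_self (by positivity)⟩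
      ((hff₀ m).trans (hff₀ n).symm) ⟨hm, hn⟩
  refine ⟨fun u => f (N u) u, fun u => (hf (N u) u (hN u)).congr ?_⟩
  filter_upwards [Metric.isOpen_ball.mem_nhds (Metric.mem_ball.2 (hN u))] with v hv
  exact hagree _ _ _ hv (hN v)

/-- An inverse of the developing map: a closed hyperbolic surface receives an oriented local
isometry from all of `ℍ`, which is injective on all discs of some fixed radius. -/
theorem exists_developing [HasGroupoid M hyperbolicGroupoid] [T2Space M] [CompactSpace M]
    [Nonempty M] : ∃ (f : ℍ → M) (ε : ℝ), 0 < ε ∧ (∀ z, IsOrientedLocalIsometryAt f z) ∧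
      ∀ z, Set.InjOn f (Metric.ball z ε) := by
  obtain ⟨ε, hε, hext⟩ := exists_uniform_extension (M := M)
  obtain ⟨p⟩ := ‹Nonempty M›
  obtain ⟨γ, hγ⟩ := MulAction.exists_smul_eq SL(2, ℝ) UpperHalfPlane.I (chartAt ℍ p p)
  have hf₀ : IsOrientedLocalIsometryAt (fun w => (chartAt ℍ p).symm (γ • w)) UpperHalfPlane.I :=
    .symm_smul (chart_mem_atlas ℍ p) (hγ ▸ mem_chart_target ℍ p)
  obtain ⟨f, hf⟩ := exists_global_of_extension hε (fun f w hfw => by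
    obtain ⟨g, hg, -, hfg⟩ := hext f w hfw
    exact ⟨g, hg, hfg⟩) hf₀
  refine ⟨f, ε, hε, hf, fun z => ?_⟩
  obtain ⟨g, hg, hinj, hfg⟩ := hext f z (hf z)
  exact hinj.congr (eqOn_of_isPreconnected (isPreconnected_ball z ε) (fun w _ => hf w) hg
    (Metric.mem_ball_self hε) hfg).symm

/-! ### The deck group of a map from the hyperbolic plane -/

/-- The group of all `γ` in `SL(2, ℝ)` under which `f` is invariant. It contains `-1`, which acts
trivially on `ℍ`. -/
def deckSubgroup {M : Type*} (f : ℍ → M) : Subgroup SL(2, ℝ) where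
  carrier := {γ | ∀ w, f (γ • w) = f w}
  mul_mem' {γ δ} hγ hδ w := by rw [mul_smul, hγ, hδ]
  one_mem' w := by rw [one_smul]
  inv_mem' {γ} hγ w := by rw [← hγ, smul_inv_smul]

theorem le_dist_smul_of_mem_deckSubgroup {M : Type*} {f : ℍ → M} {ε : ℝ}
    (hinj : ∀ z, Set.InjOn f (Metric.ball z ε)) (hε : 0 < ε) {γ : SL(2, ℝ)}
    (hγ : γ ∈ deckSubgroup f) (h1 : γ ≠ 1) (h1' : γ ≠ -1) (z : ℍ) : ε ≤ dist z (γ • z) := by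
  by_contra! hlt
  have hfix : γ • z = z := hinj z (by rwa [Metric.mem_ball, dist_comm])
    (Metric.mem_ball_self hε) (hγ z)
  refine (eq_one_or_eq_neg_one_of_eventually_smul_eq (z := z) ?_).elim h1 h1'
  filter_upwards [Metric.ball_mem_nhds z hε] with w hw
  refine hinj z ?_ hw (hγ w)
  rwa [Metric.mem_ball, ← hfix, dist_smul, ← Metric.mem_ball]

/-- Read in a common chart, the germs of `f` at `w` and at `w'` differ by a Möbius transformation,
which leaves `f` invariant by the identity principle. -/
theorem exists_mem_deckSubgroup_smul_eq [HasGroupoid M hyperbolicGroupoid] [T2Space M]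
    {f : ℍ → M} (hf : ∀ z, IsOrientedLocalIsometryAt f z) {w w' : ℍ} (h : f w = f w') :
    ∃ γ ∈ deckSubgroup f, γ • w = w' := by
  obtain ⟨α, hα⟩ := (hf w).exists_eventually_eq_smul (chart_mem_atlas ℍ (f w))
    (mem_chart_source ℍ (f w))
  obtain ⟨β, hβ⟩ := (hf w').exists_eventually_eq_smul (chart_mem_atlas ℍ (f w))
    (h ▸ mem_chart_source ℍ (f w))
  have hw : (β⁻¹ * α) • w = w' := by
    have he : β • w' = α • w := by
      rw [← hβ.self_of_nhds.2, ← hα.self_of_nhds.2, h]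
    rw [mul_smul, ← he, inv_smul_smul]
  refine ⟨β⁻¹ * α, fun v => ?_, hw⟩
  refine eqOn_of_isPreconnected (f := fun v => f ((β⁻¹ * α) • v)) (z₀ := w) (s := Set.univ)
    isPreconnected_univ (fun z _ => (hf _).comp_smul) (fun z _ => hf z) (Set.mem_univ w) ?_
    (Set.mem_univ v)
  have hc : ContinuousAt (fun v : ℍ => (β⁻¹ * α) • v) w :=
    (isometry_smul ℍ _).continuous.continuousAt
  rw [ContinuousAt, hw] at hc
  filter_upwards [hα, hc.eventually hβ] with v h1 h2
  refine (chartAt ℍ (f w)).injOn h2.1 h1.1 ?_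
  rw [h2.2, h1.2, mul_smul, smul_inv_smul]

theorem hasEmbeddedDisc_of_forall_dist_smul_ge [HasGroupoid M hyperbolicGroupoid] [T2Space M]
    {f : ℍ → M} (hf : ∀ z, IsOrientedLocalIsometryAt f z) {z : ℍ} {r : ℝ}
    (h : ∀ γ ∈ deckSubgroup f, γ ≠ 1 → γ ≠ -1 → 2 * r ≤ dist z (γ • z)) :
    HasEmbeddedDisc (f z) r := by
  refine ⟨z, f, rfl, fun w _ => ?_, fun w hw w' hw' hww' => ?_⟩
  · obtain ⟨γ, hγ⟩ := (hf w).exists_eventually_eq_smul (chart_mem_atlas ℍ (f w))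
      (mem_chart_source ℍ (f w))
    exact ⟨IsometryEquiv.constSMul γ, hγ⟩
  · obtain ⟨γ, hγ, rfl⟩ := exists_mem_deckSubgroup_smul_eq hf hww'
    by_cases h1 : γ = 1
    · rw [h1, one_smul]
    by_cases h1' : γ = -1
    · rw [h1', neg_smul_eq_smul, one_smul]
    -- `d(z, γ z) ≤ d(z, γ w) + d(γ w, γ z) < 2 r`
    have h2 := dist_triangle z (γ • w) (γ • z)
    rw [dist_smul, dist_comm z (γ • w)] at h2
    rw [Metric.mem_ball] at hw hw'
    linarith [h γ hγ h1 h1']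

end LocalIsometry

end HyperbolicSurface

theorem lemmaA1 (M : Type*) [TopologicalSpace M] [ChartedSpace ℍ M] [ClosedHyperbolicSurface M] :
    ∃ p : M, ENNReal.ofReal 0.13 ≤ injectivityRadius p := by
  obtain ⟨f, ε, hε, hf, hinj⟩ := HyperbolicSurface.exists_developing (M := M)
  obtain ⟨z, hz⟩ := HyperbolicSurface.exists_forall_dist_smul_ge hε fun γ hγ h1 h1' =>
    HyperbolicSurface.le_dist_smul_of_mem_deckSubgroup hinj hε hγ h1 h1'
  refine ⟨f z, ?_⟩
  have hdisc : HasEmbeddedDisc (f z) (Real.toNNReal 0.13) := by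
    refine HyperbolicSurface.hasEmbeddedDisc_of_forall_dist_smul_ge hf fun γ hγ h1 h1' => ?_
    rw [Real.coe_toNNReal _ (by norm_num)]
    linarith [hz γ hγ h1 h1']
  exact le_iSup₂_of_le (Real.toNNReal 0.13) hdisc le_rfl
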